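/- Let $h\colon[-e^{-1},e^{-1}]\to\mathbb R$ be given by $h(0)=0$ and $h(x)=|x|\,\bigl(\log\bigl|\log\frac{|x|}{e}\bigr|\bigr)^{-1/2}$ for $x\neq 0$, extend it to a $2\pi$-periodic $C^1$ function $h\colon\mathbb R\to\mathbb R$ (any such extension), and let $g$ be the function on the unit circle $\mathbb T\subset\mathbb C$ with $g(e^{i\theta})=h(\theta)$ for all $\theta\in\mathbb R$. Then there is a constant $c>0$, not depending on $n$, such that for every integer $n\ge 3$ there exist unitary operators $H_n,K_n$ on the Hilbert space $\ell^2_{2n+1}=\mathbb C^{2n+1}$ with $$H_n\neq K_n,\qquad \sigma(H_n)=\sigma(K_n),\qquad 1\in\sigma(H_n),$$ and $$\|g(K_n)-g(H_n)\|\ \ge\ c\,(\log n)^{1/2}\,\|K_n-H_n\|,$$ where $\sigma$ denotes the spectrum, $g(\cdot)$ is defined by the functional calculus for normal operators, and $\|\cdot\|$ is the operator norm. -/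

import Mathlib

/-- The function `x ↦ |x| (log |log (|x| / e)|)^(-1/2)`, with value `0` at `0`.
Only its values on `[-e⁻¹, e⁻¹]` are used; there `|log (|x| / e)| ≥ 2` for `x ≠ 0`. -/
noncomputable def hLocal (x : ℝ) : ℝ :=
  if x = 0 then 0
  else |x| * (Real.log |Real.log (|x| / Real.exp 1)|) ^ (-(1 / 2) : ℝ)

/-- `h` is a `2π`-periodic `C¹` extension of the restriction of `hLocal` to `[-e⁻¹, e⁻¹]`. -/
structure IsPeriodicExtension (h : ℝ → ℝ) : Prop where
  contDiff : ContDiff ℝ 1 h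
  periodic : Function.Periodic h (2 * Real.pi)
  eqOn : Set.EqOn h hLocal (Set.Icc (-(Real.exp 1)⁻¹) (Real.exp 1)⁻¹)

/-- The bounded operators on `ℓ²_N`, i.e. on `ℂ^N` with its Euclidean norm. -/
abbrev OpEll2 (N : ℕ) : Type :=
  EuclideanSpace ℂ (Fin N) →L[ℂ] EuclideanSpace ℂ (Fin N)

/-!
Conjugating a unitary `y` by `exp (i t x)` with `x` self-adjoint changes `y` by `t ‖x y - y x‖` and
`g(y)` by `t ‖x g(y) - g(y) x‖` to first order as `t → 0`, so it suffices to find `x` for which the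
second commutator is much larger than the first. Let `y` be diagonal with eigenvalues
`exp (i θ_a)` and let `x` have the entries `1 / (2 (a - b) sin ((θ_b - θ_a) / 2))`. Up to unimodular
factors `x y - y x` is then the Hilbert matrix `1 / (a - b)`, the Toeplitz matrix of a bounded
function, of norm at most `π`. For `θ_0 = 0` and `θ_a = (-1)^a e^{-a}` the entries of
`x g(y) - g(y) x` in odd rows and nonzero even columns are at least a constant times
`(log n)^{-1/2} / |a - b|`, and these lower bounds have row sums of order `(log n)^{1/2}`.
-/

section UnitaryConjugation

open Filter Topology Unitary

variable {A : Type*} [CStarAlgebra A]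

theorem hasDerivAt_conj_expUnitary (x : selfAdjoint A) (y : A) :
    HasDerivAt (fun t : ℝ => conjStarAlgAut ℂ A (selfAdjoint.expUnitary (t • x)) y)
      (Complex.I • (x * y - y * x)) 0 := by
  have hexp : HasDerivAt (fun t : ℝ => (selfAdjoint.expUnitary (t • x) : A))
      (Complex.I • (x : A)) 0 := by
    simpa [smul_comm Complex.I] using
      hasDerivAt_exp_smul_const (𝕂 := ℝ) (Complex.I • (x : A)) 0
  convert! (hexp.mul_const y).mul hexp.star using 1
  simp [sub_eq_add_neg]

theorem tendsto_norm_slope_conj_expUnitary (x : selfAdjoint A) (y : A) :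
    Tendsto (fun t : ℝ =>
        t⁻¹ * ‖conjStarAlgAut ℂ A (selfAdjoint.expUnitary (t • x)) y - y‖)
      (𝓝[>] 0) (𝓝 ‖x * y - y * x‖) := by
  have h := (hasDerivAt_conj_expUnitary x y).tendsto_slope_zero_right.norm
  rw [norm_smul, Complex.norm_I, one_mul] at h
  refine h.congr' ?_
  filter_upwards [self_mem_nhdsWithin] with t (ht : 0 < t)
  simp [norm_smul, abs_of_pos ht]

theorem exists_unitary_mul_norm_conj_sub_lt {x : A} (hx : IsSelfAdjoint x) {y z : A} {C : ℝ}
    (h : C * ‖x * y - y * x‖ < ‖x * z - z * x‖) :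
    ∃ u : unitary A,
      C * ‖conjStarAlgAut ℂ A u y - y‖ < ‖conjStarAlgAut ℂ A u z - z‖ := by
  lift x to selfAdjoint A using hx
  have hy := (tendsto_norm_slope_conj_expUnitary x y).const_mul C
  have hz := tendsto_norm_slope_conj_expUnitary x z
  obtain ⟨t, hlt, ht⟩ := ((hy.eventually_lt hz h).and self_mem_nhdsWithin).exists
  refine ⟨selfAdjoint.expUnitary (t • x), ?_⟩
  rw [mul_left_comm] at hlt
  exact lt_of_mul_lt_mul_left hlt (inv_nonneg.2 ht.le)

theorem cfc_conjStarAlgAut {g : ℂ → ℂ} {a : A} [IsStarNormal a]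
    (hg : ContinuousOn g (spectrum ℂ a)) (u : unitary A) :
    cfc g (conjStarAlgAut ℂ A u a) = conjStarAlgAut ℂ A u (cfc g a) := by
  have hcont : Continuous (conjStarAlgAut ℂ A u) := by
    have : Continuous fun b : A => (u : A) * b * star (u : A) := by fun_prop
    exact this
  exact (StarAlgHomClass.map_cfc (conjStarAlgAut ℂ A u) g a hg hcont).symm

theorem exists_unitary_mul_norm_sub_lt_norm_cfc_sub {x y : A} (hx : IsSelfAdjoint x)
    (hy : y ∈ unitary A) {g : ℂ → ℂ} (hg : ContinuousOn g (spectrum ℂ y)) {C : ℝ}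
    (h : C * ‖x * y - y * x‖ < ‖x * cfc g y - cfc g y * x‖) :
    ∃ z ∈ unitary A, spectrum ℂ z = spectrum ℂ y ∧ C * ‖z - y‖ < ‖cfc g z - cfc g y‖ := by
  obtain ⟨u, hu⟩ := exists_unitary_mul_norm_conj_sub_lt hx h
  have : IsStarNormal y := coe_isStarNormal ⟨y, hy⟩
  rw [← cfc_conjStarAlgAut hg] at hu
  exact ⟨conjStarAlgAut ℂ A u y, Unitary.map_mem _ hy, AlgEquiv.spectrum_eq _ y, hu⟩

end UnitaryConjugation

section DiagonalMatrices

open Matrix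
open scoped Matrix.Norms.L2Operator

variable {ι : Type*} [Fintype ι] [DecidableEq ι]

/-- `Matrix.diagonal` as a star homomorphism, so that it commutes with the functional calculus. -/
def diagonalStarAlgHom (ι : Type*) [Fintype ι] [DecidableEq ι] : (ι → ℂ) →⋆ₐ[ℂ] Matrix ι ι ℂ where
  toAlgHom := Matrix.diagonalAlgHom ℂ
  map_star' d := (Matrix.diagonal_conjTranspose d).symm

theorem diagonal_mem_unitary {d : ι → ℂ} (hd : ∀ a, ‖d a‖ = 1) :
    diagonal d ∈ unitary (Matrix ι ι ℂ) := by
  refine Unitary.map_mem (diagonalStarAlgHom ι) (Unitary.mem_iff.2 ⟨?_, ?_⟩) <;>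
  · ext a
    simp [Complex.conj_mul', Complex.mul_conj', hd]

theorem spectrum_toEuclideanCLM_diagonal (d : ι → ℂ) :
    spectrum ℂ (toEuclideanCLM (𝕜 := ℂ) (diagonal d)) = Set.range d := by
  rw [AlgEquiv.spectrum_eq, spectrum_diagonal]

theorem cfc_toEuclideanCLM_diagonal (g : ℂ → ℂ) (d : ι → ℂ) :
    cfc g (toEuclideanCLM (𝕜 := ℂ) (diagonal d)) = toEuclideanCLM (𝕜 := ℂ) (diagonal (g ∘ d)) := by
  let φ : (ι → ℂ) →⋆ₐ[ℂ] (EuclideanSpace ℂ ι →L[ℂ] EuclideanSpace ℂ ι) :=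
    (toEuclideanCLM (n := ι) (𝕜 := ℂ)).toStarAlgHom.comp (diagonalStarAlgHom ι)
  have hφ : Continuous φ := φ.toLinearMap.continuous_of_finiteDimensional
  have hd : IsStarNormal d := ⟨mul_comm _ _⟩
  have hg : ContinuousOn g (⋃ a, spectrum ℂ (d a)) :=
    (Set.finite_iUnion fun a =>
      spectrum.scalar_eq (A := ℂ) (d a) ▸ Set.finite_singleton (d a)).continuousOn g
  have hcfc : cfc g d = g ∘ d := by
    rw [cfc_map_pi (S := ℂ) g d hg hd fun a => ⟨mul_comm _ _⟩]
    exact funext fun a => cfc_algebraMap (d a) g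
  rw [← Pi.spectrum_eq] at hg
  rw [← hcfc]
  exact (φ.map_cfc g d hg hφ hd (hd.map φ)).symm

theorem mul_diagonal_sub_diagonal_mul (M : Matrix ι ι ℂ) (d : ι → ℂ) :
    M * diagonal d - diagonal d * M = of fun a b => M a b * (d b - d a) := by
  ext a b
  simp [mul_sub, mul_comm]

end DiagonalMatrices

section ToeplitzMatrices

open Matrix MeasureTheory AddCircle
open scoped Matrix.Norms.L2Operator InnerProductSpace ENNReal

theorem norm_of_inner_le_opNorm {𝕜 E F ι κ : Type*} [RCLike 𝕜] [NormedAddCommGroup E]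
    [InnerProductSpace 𝕜 E] [NormedAddCommGroup F] [InnerProductSpace 𝕜 F] [Fintype ι] [Fintype κ]
    [DecidableEq κ] {e : ι → F} {f : κ → E} (he : Orthonormal 𝕜 e) (hf : Orthonormal 𝕜 f)
    (T : E →L[𝕜] F) : ‖(of fun a b => ⟪e a, T (f b)⟫_𝕜 : Matrix ι κ 𝕜)‖ ≤ ‖T‖ := by
  rw [l2_opNorm_def]
  refine ContinuousLinearMap.opNorm_le_bound _ (norm_nonneg T) fun v => ?_
  set w : E := ∑ b, v b • f b
  have hw : ‖w‖ = ‖v‖ := by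
    rw [← sq_eq_sq₀ (norm_nonneg w) (norm_nonneg v), EuclideanSpace.norm_sq_eq,
      @norm_sq_eq_re_inner 𝕜, hf.inner_sum]
    simp only [RCLike.conj_mul, map_sum]
    norm_cast
  calc _ = ‖WithLp.toLp 2 fun a => ⟪e a, T w⟫_𝕜‖ := by
        congr 1
        ext a
        simp [w, mulVec, dotProduct, inner_sum, inner_smul_right, mul_comm]
    _ ≤ ‖T w‖ := by
        rw [← sq_le_sq₀ (norm_nonneg _) (norm_nonneg _), EuclideanSpace.norm_sq_eq]
        exact he.sum_inner_products_le (T w)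
    _ ≤ ‖T‖ * ‖v‖ := hw ▸ T.le_opNorm w

theorem norm_of_fourierCoeff_sub_le {T : ℝ} [Fact (0 < T)] {ι : Type*} [Fintype ι] [DecidableEq ι]
    {m : ι → ℤ} (hm : Function.Injective m) (φ : Lp ℂ ∞ (haarAddCircle (T := T))) :
    ‖(of fun a b => fourierCoeff φ (m a - m b) : Matrix ι ι ℂ)‖ ≤ ‖φ‖ := by
  let M : Lp ℂ 2 (haarAddCircle (T := T)) →L[ℂ] Lp ℂ 2 (haarAddCircle (T := T)) :=
    (ContinuousLinearMap.mul ℂ ℂ).holderL haarAddCircle ∞ 2 2 φ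
  have hM : ‖M‖ ≤ ‖φ‖ := by
    have hmul := ((ContinuousLinearMap.mul ℂ ℂ).norm_holderL_le (μ := haarAddCircle (T := T))
      (p := ∞) (q := 2) (r := 2)).trans (ContinuousLinearMap.opNorm_mul_le ℂ ℂ)
    simpa using ContinuousLinearMap.le_of_opNorm_le _ hmul φ
  have he := orthonormal_fourier (T := T).comp m hm
  convert! (norm_of_inner_le_opNorm he he M).trans hM using 3
  ext a b
  rw [L2.inner_def]
  refine integral_congr_ae ?_
  filter_upwards [coeFn_fourierLp (T := T) 2 (m a), coeFn_fourierLp (T := T) 2 (m b),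
    (ContinuousLinearMap.mul ℂ ℂ).coeFn_holder (r := 2) φ (fourierLp (T := T) 2 (m b))]
    with t ha hb hMb
  have hMb' : M (fourierLp 2 (m b)) t = φ t * fourierLp 2 (m b) t := hMb
  simp only [Function.comp_apply, RCLike.inner_apply, ha, hMb', hb]
  rw [neg_sub, sub_eq_add_neg, fourier_add, fourier_neg, smul_eq_mul]
  ring

theorem measurable_periodizedBernoulli_one : Measurable (periodizedBernoulli 1) := by
  refine Measurable.comp (g := fun x : Set.Ico (0 : ℝ) (0 + 1) => bernoulliFun 1 x) ?_
    (measurableEquivIco 1 0).measurable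
  simp only [bernoulliFun_one]
  fun_prop

theorem abs_periodizedBernoulli_one_le (x : UnitAddCircle) : |periodizedBernoulli 1 x| ≤ 1 / 2 := by
  have hx := (equivIco 1 0 x).2
  change |bernoulliFun 1 (equivIco 1 0 x)| ≤ 1 / 2
  rw [bernoulliFun_one, abs_le]
  constructor <;> linarith [hx.1, hx.2]

/-- `k ↦ 1 / k`, with value `0` at `k = 0`, is up to a constant the Fourier transform of the
first Bernoulli function. -/
theorem norm_of_one_div_sub_le {ι : Type*} [Fintype ι] [DecidableEq ι] {m : ι → ℤ}
    (hm : Function.Injective m) :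
    ‖(of fun a b => 1 / ((m a : ℂ) - m b) : Matrix ι ι ℂ)‖ ≤ Real.pi := by
  let B : UnitAddCircle → ℂ := (↑) ∘ periodizedBernoulli 1
  have hbound (x : UnitAddCircle) : ‖B x‖ ≤ 1 / 2 := by
    simpa [B] using abs_periodizedBernoulli_one_le x
  have hB : MemLp B ∞ haarAddCircle :=
    memLp_top_of_bound
      (Complex.measurable_ofReal.comp measurable_periodizedBernoulli_one).aestronglyMeasurable _
      (.of_forall hbound)
  have hnorm : ‖hB.toLp‖ ≤ 1 / 2 := by
    have hB_ae : ∀ᵐ x ∂haarAddCircle, ‖hB.toLp B x‖ ≤ 1 / 2 := by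
      filter_upwards [hB.coeFn_toLp] with x hx
      exact hx ▸ hbound x
    simpa using Lp.norm_le_of_ae_bound (by norm_num) hB_ae
  have hcoeff : (of fun a b => 1 / ((m a : ℂ) - m b) : Matrix ι ι ℂ) =
      (-(2 * Real.pi * Complex.I) : ℂ) • of fun a b => fourierCoeff hB.toLp (m a - m b) := by
    ext a b
    rw [Matrix.smul_apply, of_apply, of_apply, fourierCoeff_congr_ae hB.coeFn_toLp,
      fourierCoeff_bernoulli_eq one_ne_zero]
    rcases eq_or_ne (m a - m b : ℂ) 0 with h | h
    · simp [h]
    · simp only [Nat.factorial_one, Nat.cast_one, pow_one, smul_eq_mul, Int.cast_sub]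
      field_simp [Complex.ofReal_ne_zero.2 Real.pi_ne_zero]
  calc _ = 2 * Real.pi * ‖(of fun a b => fourierCoeff hB.toLp (m a - m b) : Matrix ι ι ℂ)‖ := by
        rw [hcoeff, norm_smul]
        simp [abs_of_pos Real.pi_pos]
    _ ≤ 2 * Real.pi * (1 / 2) := by
        gcongr
        exact (norm_of_fourierCoeff_sub_le hm _).trans hnorm
    _ = Real.pi := by ring

end ToeplitzMatrices

section CommutatorKernel

open Matrix
open scoped Matrix.Norms.L2Operator

variable {ι : Type*} {m : ι → ℤ} {θ : ι → ℝ}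

/-- A real symmetric matrix whose commutator with the diagonal unitary `exp (i θ)` is the Hilbert
matrix `1 / (m a - m b)`, up to unimodular factors on rows and columns. The diagonal entries are
`1 / 0 = 0`. -/
noncomputable def commutatorKernel (m : ι → ℤ) (θ : ι → ℝ) : Matrix ι ι ℂ :=
  of fun a b => ((1 / ((m a - m b) * (2 * Real.sin ((θ b - θ a) / 2))) : ℝ) : ℂ)

/-- The diagonal unitary matrix with eigenvalue arguments `θ`. -/
noncomputable def expDiagonal [DecidableEq ι] (θ : ι → ℝ) : Matrix ι ι ℂ :=
  diagonal fun a => Complex.exp (Complex.I * θ a)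

theorem expDiagonal_mem_unitary [Fintype ι] [DecidableEq ι] (θ : ι → ℝ) :
    expDiagonal θ ∈ unitary (Matrix ι ι ℂ) :=
  diagonal_mem_unitary fun a => Complex.norm_exp_I_mul_ofReal (θ a)

theorem isSelfAdjoint_commutatorKernel : IsSelfAdjoint (commutatorKernel m θ) := by
  ext a b
  rw [star_apply, commutatorKernel, of_apply, of_apply, Complex.star_def, Complex.conj_ofReal,
    ← neg_sub (m a : ℝ), ← neg_sub (θ b), neg_div, Real.sin_neg]
  ring_nf

theorem exp_I_mul_sub_exp_I_mul (α β : ℂ) :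
    Complex.exp (Complex.I * β) - Complex.exp (Complex.I * α) =
      Complex.I * Complex.exp (Complex.I * (α / 2)) * (2 * Complex.sin ((β - α) / 2)) *
        Complex.exp (Complex.I * (β / 2)) := by
  have hβ : Complex.I * β =
      Complex.I * (α / 2) + (β - α) / 2 * Complex.I + Complex.I * (β / 2) := by ring
  have hα : Complex.I * α =
      Complex.I * (α / 2) + -((β - α) / 2) * Complex.I + Complex.I * (β / 2) := by ring
  rw [Complex.two_sin, hα, hβ]
  simp only [Complex.exp_add]
  linear_combination (-Complex.exp (Complex.I * (α / 2)) * Complex.exp (Complex.I * (β / 2)) *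
    (Complex.exp (-((β - α) / 2) * Complex.I) - Complex.exp ((β - α) / 2 * Complex.I))) *
      Complex.I_sq

theorem sin_half_sub_ne_zero {α β : ℝ} (hα : |α| < Real.pi) (hβ : |β| < Real.pi) (h : α ≠ β) :
    Real.sin ((β - α) / 2) ≠ 0 := by
  rw [abs_lt] at hα hβ
  rw [Ne, Real.sin_eq_zero_iff_of_lt_of_lt (by linarith) (by linarith)]
  exact div_ne_zero (sub_ne_zero.2 h.symm) two_ne_zero

theorem commutatorKernel_mul_exp_sub (hm : Function.Injective m) (hθ : Function.Injective θ)
    (hπ : ∀ a, |θ a| < Real.pi) (a b : ι) :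
    commutatorKernel m θ a b *
        (Complex.exp (Complex.I * θ b) - Complex.exp (Complex.I * θ a)) =
      Complex.I * Complex.exp (Complex.I * (θ a / 2)) * (1 / (m a - m b)) *
        Complex.exp (Complex.I * (θ b / 2)) := by
  rcases eq_or_ne a b with rfl | hab
  · simp
  have hm' : (m a - m b : ℂ) ≠ 0 := by
    exact_mod_cast sub_ne_zero.2 (hm.ne hab)
  have hsin : Complex.sin ((θ b - θ a) / 2) ≠ 0 := by
    exact_mod_cast sin_half_sub_ne_zero (hπ a) (hπ b) (hθ.ne hab)
  rw [exp_I_mul_sub_exp_I_mul, commutatorKernel, of_apply]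
  push_cast
  field_simp

theorem norm_commutatorKernel_commutator_le [Fintype ι] [DecidableEq ι]
    (hm : Function.Injective m) (hθ : Function.Injective θ) (hπ : ∀ a, |θ a| < Real.pi) :
    ‖commutatorKernel m θ * expDiagonal θ - expDiagonal θ * commutatorKernel m θ‖ ≤ Real.pi := by
  have hfactor : commutatorKernel m θ * expDiagonal θ - expDiagonal θ * commutatorKernel m θ =
      Complex.I • (expDiagonal (fun a => θ a / 2) * of (fun a b => 1 / ((m a : ℂ) - m b)) *
        expDiagonal fun a => θ a / 2) := by
    ext a b
    rw [expDiagonal, expDiagonal, mul_diagonal_sub_diagonal_mul, Matrix.smul_apply, mul_diagonal,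
      diagonal_mul, of_apply, of_apply, commutatorKernel_mul_exp_sub hm hθ hπ, smul_eq_mul]
    push_cast
    ring
  have hU := expDiagonal_mem_unitary fun a => θ a / 2
  rw [hfactor, norm_smul, Complex.norm_I, one_mul, CStarRing.norm_mul_mem_unitary _ hU,
    CStarRing.norm_mem_unitary_mul _ hU]
  exact norm_of_one_div_sub_le hm

end CommutatorKernel

section RowSums

open Matrix
open scoped Matrix.Norms.L2Operator InnerProductSpace

theorem norm_submatrix_le {𝕜 ι ι' κ κ' : Type*} [RCLike 𝕜] [Fintype ι] [Fintype ι'] [Fintype κ]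
    [Fintype κ'] [DecidableEq ι'] [DecidableEq κ'] (M : Matrix ι ι' 𝕜) {p : κ → ι} {q : κ' → ι'}
    (hp : Function.Injective p) (hq : Function.Injective q) : ‖M.submatrix p q‖ ≤ ‖M‖ := by
  classical
  rw [l2_opNorm_def M]
  convert norm_of_inner_le_opNorm ((EuclideanSpace.basisFun ι 𝕜).orthonormal.comp p hp)
    ((EuclideanSpace.basisFun ι' 𝕜).orthonormal.comp q hq) _ using 2
  ext a b
  simp [EuclideanSpace.inner_single_left]

theorem le_norm_of_le_re_row_sum {𝕜 κ : Type*} [RCLike 𝕜] [Fintype κ] [DecidableEq κ]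
    [Nonempty κ] {M : Matrix κ κ 𝕜} {r : ℝ} (h : ∀ i, r ≤ RCLike.re (∑ j, M i j)) : r ≤ ‖M‖ := by
  let v : EuclideanSpace 𝕜 κ := WithLp.toLp 2 1
  have hv : ‖v‖ ^ 2 = Fintype.card κ := by simp [v, EuclideanSpace.norm_sq_eq]
  have hcard : (0 : ℝ) < Fintype.card κ := by exact_mod_cast Fintype.card_pos
  refine le_of_mul_le_mul_left ?_ hcard
  calc Fintype.card κ * r = ∑ _ : κ, r := by simp
    _ ≤ ∑ i, RCLike.re (∑ j, M i j) := Finset.sum_le_sum fun i _ => h i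
    _ = RCLike.re ⟪v, WithLp.toLp 2 (M *ᵥ v)⟫_𝕜 := by
        simp [v, PiLp.inner_apply, mulVec, dotProduct]
    _ ≤ ‖v‖ * (‖M‖ * ‖v‖) :=
        (re_inner_le_norm _ _).trans (by gcongr; exact l2_opNorm_mulVec M v)
    _ = Fintype.card κ * ‖M‖ := by rw [← hv]; ring

end RowSums

section Angles

/-- The arguments `0, -e⁻¹, e⁻², -e⁻³, …` of the eigenvalues. The even function `hLocal` takes
markedly different values at a negative and a positive one, since their absolute values differ by
a factor of at least `e`. -/
noncomputable def eigAngle (a : ℕ) : ℝ := if a = 0 then 0 else (-1) ^ a * Real.exp (-a)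

theorem abs_eigAngle {a : ℕ} (ha : a ≠ 0) : |eigAngle a| = Real.exp (-a) := by
  simp [eigAngle, ha, abs_mul]

theorem abs_eigAngle_le (a : ℕ) : |eigAngle a| ≤ (Real.exp 1)⁻¹ := by
  rcases eq_or_ne a 0 with rfl | ha
  · simpa [eigAngle] using (Real.exp_pos 1).le
  · have : (1 : ℝ) ≤ a := by exact_mod_cast Nat.one_le_iff_ne_zero.2 ha
    rw [abs_eigAngle ha, ← Real.exp_neg]
    exact Real.exp_le_exp.2 (by linarith)

theorem abs_eigAngle_lt_pi (a : ℕ) : |eigAngle a| < Real.pi :=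
  calc |eigAngle a| ≤ (Real.exp 1)⁻¹ := abs_eigAngle_le a
    _ ≤ 1 := inv_le_one_of_one_le₀ (Real.one_le_exp zero_le_one)
    _ < Real.pi := by linarith [Real.pi_gt_three]

theorem eigAngle_eq_zero_iff {a : ℕ} : eigAngle a = 0 ↔ a = 0 := by
  simp [eigAngle]

theorem eigAngle_injective : Function.Injective eigAngle := by
  intro a b hab
  rcases eq_or_ne a 0 with rfl | ha
  · exact (eigAngle_eq_zero_iff.1 (hab.symm.trans (if_pos rfl))).symm
  have hb : b ≠ 0 := by
    rwa [Ne, ← eigAngle_eq_zero_iff, ← hab, eigAngle_eq_zero_iff]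
  have habs := congrArg abs hab
  rw [abs_eigAngle ha, abs_eigAngle hb, Real.exp_eq_exp] at habs
  exact_mod_cast neg_injective habs

theorem eigAngle_sub_of_odd_of_even {j k : ℕ} (hj : Odd j) (hk : Even k) (hk0 : k ≠ 0) :
    eigAngle k - eigAngle j = Real.exp (-j) + Real.exp (-k) := by
  rw [eigAngle, eigAngle, if_neg hk0, if_neg hj.pos.ne', hk.neg_one_pow, hj.neg_one_pow]
  ring

theorem hLocal_eigAngle {j : ℕ} (hj : j ≠ 0) :
    hLocal (eigAngle j) = Real.exp (-j) * Real.log (j + 1) ^ (-(1 / 2) : ℝ) := by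
  have hlog : |Real.log (|eigAngle j| / Real.exp 1)| = j + 1 := by
    rw [abs_eigAngle hj, ← Real.exp_sub, Real.log_exp, ← abs_neg]
    ring_nf
    exact abs_of_pos (by positivity)
  rw [hLocal, if_neg (eigAngle_eq_zero_iff.not.2 hj), hlog, abs_eigAngle hj]

theorem le_hLocal_eigAngle_sub {N j k : ℕ} (hj : j ≠ 0) (hjk : j < k) (hk : k ≤ N) :
    1 / 3 * Real.log (N + 1) ^ (-(1 / 2) : ℝ) * (Real.exp (-j) + Real.exp (-k)) ≤
      hLocal (eigAngle j) - hLocal (eigAngle k) := by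
  have hj' : (1 : ℝ) ≤ j := by exact_mod_cast Nat.one_le_iff_ne_zero.2 hj
  have hjk' : (j : ℝ) + 1 ≤ k := by exact_mod_cast hjk
  have hk' : (k : ℝ) ≤ N := by exact_mod_cast hk
  have hanti (x : ℝ) (hx : j ≤ x) :
      Real.log (x + 1) ^ (-(1 / 2) : ℝ) ≤ Real.log (j + 1) ^ (-(1 / 2) : ℝ) :=
    Real.rpow_le_rpow_of_nonpos (Real.log_pos (by linarith))
      (Real.log_le_log (by linarith) (by linarith)) (by norm_num)
  have hexp : 2 * Real.exp (-k) ≤ Real.exp (-j) := by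
    calc 2 * Real.exp (-k) ≤ Real.exp 1 * Real.exp (-k) := by
          gcongr
          linarith [Real.add_one_le_exp (1 : ℝ)]
      _ ≤ Real.exp (-j) := by
          rw [← Real.exp_add]
          exact Real.exp_le_exp.2 (by linarith)
  have hN : 0 ≤ Real.log (N + 1) ^ (-(1 / 2) : ℝ) :=
    Real.rpow_nonneg (Real.log_nonneg (by linarith)) _
  rw [hLocal_eigAngle hj, hLocal_eigAngle (by omega)]
  calc 1 / 3 * Real.log (N + 1) ^ (-(1 / 2) : ℝ) * (Real.exp (-j) + Real.exp (-k))
      = Real.log (N + 1) ^ (-(1 / 2) : ℝ) * ((Real.exp (-j) + Real.exp (-k)) / 3) := by ring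
    _ ≤ Real.log (j + 1) ^ (-(1 / 2) : ℝ) * (Real.exp (-j) - Real.exp (-k)) := by
        have hNj := hanti N (by linarith)
        exact mul_le_mul hNj (by linarith) (by positivity) (hN.trans hNj)
    _ = Real.exp (-j) * Real.log (j + 1) ^ (-(1 / 2) : ℝ) -
          Real.exp (-k) * Real.log (j + 1) ^ (-(1 / 2) : ℝ) := by ring
    _ ≤ _ := sub_le_sub_left
        (mul_le_mul_of_nonneg_left (hanti k (by linarith)) (Real.exp_pos _).le) _

theorem le_hLocal_eigAngle_sub_div {N j k : ℕ} (hj : j ≠ 0) (hk : k ≠ 0) (hjN : j ≤ N)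
    (hkN : k ≤ N) :
    1 / 3 * Real.log (N + 1) ^ (-(1 / 2) : ℝ) * (Real.exp (-j) + Real.exp (-k)) / |(j : ℝ) - k| ≤
      (hLocal (eigAngle k) - hLocal (eigAngle j)) / (j - k) := by
  rcases lt_trichotomy j k with h | rfl | h
  · have hlt : (j : ℝ) < k := by exact_mod_cast h
    rw [abs_of_neg (by linarith), ← neg_div_neg_eq (hLocal (eigAngle k) - _), neg_sub, neg_sub]
    have : (0 : ℝ) < k - j := by linarith
    gcongr
    exact le_hLocal_eigAngle_sub hj h hkN
  · simp
  · have hlt : (k : ℝ) < j := by exact_mod_cast h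
    have hpos : (0 : ℝ) < j - k := by linarith
    rw [abs_of_pos hpos, add_comm (Real.exp (-j))]
    gcongr
    exact le_hLocal_eigAngle_sub hk h hjN

/-- The commutator kernel of the eigenvalue arguments `eigAngle 0, …, eigAngle N`. -/
noncomputable def eigKernel (N : ℕ) : Matrix (Fin (N + 1)) (Fin (N + 1)) ℂ :=
  commutatorKernel (fun a => (a : ℤ)) fun a => eigAngle a

theorem le_re_eigKernel_mul_hLocal_sub {N : ℕ} {j k : Fin (N + 1)} (hj : Odd (j : ℕ))
    (hk : Even (k : ℕ)) (hk0 : (k : ℕ) ≠ 0) :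
    1 / 3 * Real.log (N + 1) ^ (-(1 / 2) : ℝ) / |(j : ℝ) - k| ≤
      (eigKernel N j k * (hLocal (eigAngle k) - hLocal (eigAngle j))).re := by
  set s := Real.exp (-j) + Real.exp (-k)
  set A := 1 / 3 * Real.log (N + 1) ^ (-(1 / 2) : ℝ)
  set D := (hLocal (eigAngle k) - hLocal (eigAngle j)) / ((j : ℝ) - k)
  have hspos : 0 < s := by positivity
  have hs2 : s ≤ 2 := by
    have hexp (a : ℕ) : Real.exp (-a) ≤ 1 := Real.exp_le_one_iff.2 (by simp)
    linarith [hexp j, hexp k]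
  have hsin : 0 < Real.sin (s / 2) :=
    Real.sin_pos_of_pos_of_lt_pi (by linarith) (by linarith [Real.pi_gt_three])
  have hA : 0 ≤ A :=
    mul_nonneg (by norm_num) (Real.rpow_nonneg (Real.log_nonneg (by simp)) _)
  have hD : A * s / |(j : ℝ) - k| ≤ D :=
    le_hLocal_eigAngle_sub_div hj.pos.ne' hk0 (by omega) (by omega)
  calc A / |(j : ℝ) - k| = A * s / |(j : ℝ) - k| / s := by field_simp
    _ ≤ D / (2 * Real.sin (s / 2)) :=
        div_le_div₀ (le_trans (by positivity) hD) hD (by linarith)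
          (by linarith [Real.sin_le (half_pos hspos).le])
    _ = 1 / (((j : ℝ) - k) * (2 * Real.sin (s / 2))) *
          (hLocal (eigAngle k) - hLocal (eigAngle j)) :=
        (div_div _ _ _).trans (one_div_mul_eq_div _ _).symm
    _ = _ := by
        rw [eigKernel, commutatorKernel, Matrix.of_apply, eigAngle_sub_of_odd_of_even hj hk hk0,
          ← Complex.ofReal_sub, ← Complex.ofReal_mul, Complex.ofReal_re]
        push_cast
        rfl

end Angles

section LowerBound

open Matrix
open scoped Matrix.Norms.L2Operator

theorem log_le_two_mul_sum_one_div_abs_odd_sub_even {n i : ℕ} (hi : i < n) :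
    Real.log n ≤ 2 * ∑ k ∈ Finset.range n, 1 / |(2 * i + 1 : ℝ) - (2 * k + 2)| := by
  obtain ⟨d, rfl⟩ : ∃ d, n = i + (d + 1) := ⟨n - i - 1, by omega⟩
  have hharmonic (m : ℕ) : Real.log (m + 1) ≤ ∑ k ∈ Finset.range m, 1 / ((k : ℝ) + 1) := by
    simpa [harmonic] using log_add_one_le_harmonic m
  have hleft : Real.log (i + 1) ≤
      ∑ k ∈ Finset.range i, 2 * (1 / |(2 * i + 1 : ℝ) - (2 * k + 2)|) := by
    rw [← Finset.sum_range_reflect]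
    refine (hharmonic i).trans (Finset.sum_le_sum fun k hk => ?_)
    obtain ⟨l, rfl⟩ : ∃ l, i = k + 1 + l := ⟨i - (k + 1), by have := Finset.mem_range.1 hk; omega⟩
    rw [show k + 1 + l - 1 - k = l by omega, abs_of_pos (by push_cast; linarith), mul_one_div,
      div_le_div_iff₀ (by positivity) (by push_cast; linarith)]
    push_cast
    linarith
  have hright : Real.log ((d + 1 : ℕ) + 1) ≤
      ∑ k ∈ Finset.range (d + 1), 2 * (1 / |(2 * i + 1 : ℝ) - (2 * (i + k : ℕ) + 2)|) := by
    refine (hharmonic (d + 1)).trans (Finset.sum_le_sum fun k _ => ?_)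
    rw [abs_of_neg (by push_cast; linarith), mul_one_div,
      div_le_div_iff₀ (by positivity) (by push_cast; linarith)]
    push_cast
    linarith
  have hlog : Real.log ((i + (d + 1) : ℕ) : ℝ) ≤ Real.log (i + 1) + Real.log ((d + 1 : ℕ) + 1) := by
    rw [← Real.log_mul (by positivity) (by positivity)]
    refine Real.log_le_log (by positivity) ?_
    push_cast
    nlinarith [(by positivity : (0 : ℝ) ≤ i * d)]
  rw [Finset.mul_sum, Finset.sum_range_add]
  linarith

theorem one_half_mul_log_rpow_le {n : ℕ} (hn : 2 ≤ n) :
    1 / 2 * Real.log n ^ (1 / 2 : ℝ) ≤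
      Real.log (2 * n + 1) ^ (-(1 / 2) : ℝ) * Real.log n := by
  have hn' : (2 : ℝ) ≤ n := by exact_mod_cast hn
  have hlog : 0 < Real.log n := Real.log_pos (by linarith)
  have hlog_le : Real.log (2 * n + 1) ≤ 2 ^ 2 * Real.log n := by
    rw [show (2 : ℝ) ^ 2 = (4 : ℕ) by norm_num, ← Real.log_pow]
    refine Real.log_le_log (by linarith) ?_
    nlinarith [pow_le_pow_left₀ (by norm_num) hn' 2, sq_nonneg ((n : ℝ) ^ 2 - 2)]
  calc 1 / 2 * Real.log n ^ (1 / 2 : ℝ)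
      = (2 ^ 2 * Real.log n) ^ (-(1 / 2) : ℝ) * Real.log n := by
        rw [Real.mul_rpow (by norm_num) hlog.le, mul_assoc, ← Real.rpow_add_one hlog.ne',
          ← Real.rpow_natCast, ← Real.rpow_mul (by norm_num)]
        norm_num
    _ ≤ Real.log (2 * n + 1) ^ (-(1 / 2) : ℝ) * Real.log n := by
        gcongr ?_ * _
        exact Real.rpow_le_rpow_of_nonpos (Real.log_pos (by linarith)) hlog_le (by norm_num)

theorem norm_eigKernel_commutator_expDiagonal_le (N : ℕ) :
    letI U := expDiagonal fun a : Fin (N + 1) => eigAngle a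
    ‖eigKernel N * U - U * eigKernel N‖ ≤ Real.pi :=
  norm_commutatorKernel_commutator_le (Nat.cast_injective.comp Fin.val_injective)
    (eigAngle_injective.comp Fin.val_injective) fun a => abs_eigAngle_lt_pi a

theorem le_norm_eigKernel_commutator_hLocal {n : ℕ} (hn : 2 ≤ n) :
    letI G := diagonal fun a : Fin (2 * n + 1) => (hLocal (eigAngle a) : ℂ)
    1 / 12 * Real.log n ^ (1 / 2 : ℝ) ≤ ‖eigKernel (2 * n) * G - G * eigKernel (2 * n)‖ := by
  -- On the odd rows and nonzero even columns all entries of the commutator are positive.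
  have : Nonempty (Fin n) := ⟨⟨0, by omega⟩⟩
  let p (i : Fin n) : Fin (2 * n + 1) := ⟨2 * i + 1, by omega⟩
  let q (k : Fin n) : Fin (2 * n + 1) := ⟨2 * k + 2, by omega⟩
  have hp : Function.Injective p := fun i j h => by simpa [p, Fin.ext_iff] using h
  have hq : Function.Injective q := fun i j h => by simpa [q, Fin.ext_iff] using h
  refine le_trans (le_norm_of_le_re_row_sum fun i => ?_) (norm_submatrix_le _ hp hq)
  rw [mul_diagonal_sub_diagonal_mul, map_sum]
  calc 1 / 12 * Real.log n ^ (1 / 2 : ℝ)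
      ≤ 1 / 6 * Real.log (2 * n + 1) ^ (-(1 / 2) : ℝ) * Real.log n := by
        linarith [one_half_mul_log_rpow_le hn]
    _ ≤ 1 / 6 * Real.log (2 * n + 1) ^ (-(1 / 2) : ℝ) *
          (2 * ∑ k ∈ Finset.range n, 1 / |(2 * (i : ℕ) + 1 : ℝ) - (2 * k + 2)|) := by
        have hlog : 0 ≤ Real.log (2 * n + 1) :=
          Real.log_nonneg (le_add_of_nonneg_left (by positivity))
        gcongr
        exact log_le_two_mul_sum_one_div_abs_odd_sub_even i.2
    _ = ∑ k : Fin n, 1 / 3 * Real.log ((2 * n : ℕ) + 1) ^ (-(1 / 2) : ℝ) /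
          |((p i : ℕ) : ℝ) - (q k : ℕ)| := by
        rw [Finset.sum_range fun k => 1 / |(2 * (i : ℕ) + 1 : ℝ) - (2 * k + 2)|, Finset.mul_sum,
          Finset.mul_sum]
        refine Finset.sum_congr rfl fun k _ => ?_
        simp only [p, q]
        push_cast
        ring
    _ ≤ _ := Finset.sum_le_sum fun k _ =>
        le_re_eigKernel_mul_hLocal_sub (odd_two_mul_add_one _)
          ⟨k + 1, by simp only [q]; ring⟩ (by simp [q])

theorem log_rpow_mul_norm_eigKernel_commutator_lt {n : ℕ} (hn : 2 ≤ n) :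
    letI U := expDiagonal fun a : Fin (2 * n + 1) => eigAngle a
    letI G := diagonal fun a : Fin (2 * n + 1) => (hLocal (eigAngle a) : ℂ)
    1 / 40 * Real.log n ^ (1 / 2 : ℝ) * ‖eigKernel (2 * n) * U - U * eigKernel (2 * n)‖ <
      ‖eigKernel (2 * n) * G - G * eigKernel (2 * n)‖ := by
  calc _ ≤ 1 / 40 * Real.log n ^ (1 / 2 : ℝ) * Real.pi := by
        gcongr
        exact norm_eigKernel_commutator_expDiagonal_le (2 * n)
    _ < 1 / 12 * Real.log n ^ (1 / 2 : ℝ) := by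
        have : 0 < Real.log n ^ (1 / 2 : ℝ) :=
          Real.rpow_pos_of_pos (Real.log_pos (by exact_mod_cast hn)) _
        nlinarith [Real.pi_lt_d2]
    _ ≤ _ := le_norm_eigKernel_commutator_hLocal hn

end LowerBound

theorem theorem4p2_general {n : ℕ} (hn : 2 ≤ n) {g : ℂ → ℂ}
    (hg : ∀ θ ∈ Set.Icc (-(Real.exp 1)⁻¹) (Real.exp 1)⁻¹,
      g (Complex.exp (Complex.I * (θ : ℂ))) = (hLocal θ : ℂ)) :
    ∃ H K : OpEll2 (2 * n + 1),
      H ∈ unitary (OpEll2 (2 * n + 1)) ∧ K ∈ unitary (OpEll2 (2 * n + 1)) ∧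
      H ≠ K ∧ spectrum ℂ H = spectrum ℂ K ∧ (1 : ℂ) ∈ spectrum ℂ H ∧
      1 / 40 * Real.log n ^ (1 / 2 : ℝ) * ‖K - H‖ ≤ ‖cfc g K - cfc g H‖ := by
  let φ := Matrix.toEuclideanCLM (n := Fin (2 * n + 1)) (𝕜 := ℂ)
  let θ (a : Fin (2 * n + 1)) : ℝ := eigAngle a
  let X := φ (eigKernel (2 * n))
  let H := φ (expDiagonal θ)
  have hX : IsSelfAdjoint X := isSelfAdjoint_commutatorKernel.map φ
  have hH : H ∈ unitary (OpEll2 (2 * n + 1)) := Unitary.map_mem φ (expDiagonal_mem_unitary θ)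
  have hspec : spectrum ℂ H = Set.range fun a => Complex.exp (Complex.I * θ a) :=
    spectrum_toEuclideanCLM_diagonal _
  have hcont : ContinuousOn g (spectrum ℂ H) := hspec ▸ (Set.finite_range _).continuousOn g
  have hcfc : cfc g H = φ (Matrix.diagonal fun a => (hLocal (θ a) : ℂ)) :=
    (cfc_toEuclideanCLM_diagonal g _).trans <| congrArg (φ ∘ Matrix.diagonal) <|
      funext fun a => hg _ (abs_le.1 (abs_eigAngle_le a))
  have hcomm : 1 / 40 * Real.log n ^ (1 / 2 : ℝ) * ‖X * H - H * X‖ <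
      ‖X * cfc g H - cfc g H * X‖ := by
    rw [hcfc]
    simp only [X, H, ← map_mul, ← map_sub]
    exact log_rpow_mul_norm_eigKernel_commutator_lt hn
  obtain ⟨K, hK, hKspec, hlt⟩ := exists_unitary_mul_norm_sub_lt_norm_cfc_sub hX hH hcont hcomm
  have hne : H ≠ K := by
    rintro rfl
    simp at hlt
  exact ⟨H, K, hH, hK, hne, hKspec.symm, hspec ▸ ⟨0, by simp [θ, eigAngle]⟩, hlt.le⟩

/-- `cfc g U` is the function `g` of the normal operator `U`; only the values of `g` on the
spectrum of `U`, a subset of the unit circle when `U` is unitary, matter. -/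
theorem theorem4p2 (h : ℝ → ℝ) (hh : IsPeriodicExtension h)
    (g : ℂ → ℂ) (hg : ∀ θ : ℝ, g (Complex.exp (Complex.I * (θ : ℂ))) = (h θ : ℂ)) :
    ∃ c : ℝ, 0 < c ∧ ∀ n : ℕ, 3 ≤ n →
      ∃ H K : OpEll2 (2 * n + 1),
        H ∈ unitary (OpEll2 (2 * n + 1)) ∧ K ∈ unitary (OpEll2 (2 * n + 1)) ∧
        H ≠ K ∧ spectrum ℂ H = spectrum ℂ K ∧ (1 : ℂ) ∈ spectrum ℂ H ∧
        c * (Real.log (n : ℝ)) ^ (1 / 2 : ℝ) * ‖K - H‖ ≤ ‖cfc g K - cfc g H‖ :=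
  ⟨1 / 40, by norm_num, fun n hn =>
    theorem4p2_general (by omega) fun θ hθ => by rw [hg, hh.eqOn hθ]⟩
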